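/- Let $X$ be an infinite-dimensional complex Banach space and let $T$ be a bounded linear operator on $X$. Write $N(S)$ and $R(S)$ for the kernel and range of an operator $S$, $T^*$ for the dual operator $\varphi\mapsto\varphi\circ T$ on the dual space $X^*$, and $\sigma(T)$ for the spectrum of $T$. An operator $S$ is Fredholm if $\dim N(S)<\infty$ and $R(S)$ is closed of finite codimension; its index is $\dim N(S)-\dim N(S^*)$; $S$ is Weyl if it is Fredholm of index $0$, and $\sigma_W(T)=\{\lambda\in\mathbb C: T-\lambda I \text{ is not Weyl}\}$. Let $\sigma_a(T)$ be the approximate point spectrum (the set of $\lambda\in\mathbb C$ such that $T-\lambda I$ is not bounded below), and let $E_a(T)$ be the set of isolated points of $\sigma_a(T)$ that are eigenvalues of $T$. Let $\Pi^0(T)$ be the set of poles of the resolvent of finite rank, i.e. of those $\lambda\in\sigma(T)$ for which $T-\lambda I$ has finite ascent and finite descent (the sequences $N((T-\lambda I)^n)$ and $R((T-\lambda I)^n)$, $n\ge 0$, both become stationary) and the generalized eigenspace $\bigcup_n N((T-\lambda I)^n)$, which is the range of the spectral projection at $\lambda$, is finite-dimensional. The operator $T$ satisfies property $(Z_{E_a})$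 if $\sigma(T)\setminus\sigma_W(T)=E_a(T)$. An operator $S$ on a complex Banach space $Y$ has the single-valued extension property (SVEP) at $\lambda\in\mathbb C$ if for every connected open neighbourhood $U$ of $\lambda$ the only analytic function $f:U\to Y$ with $(S-\mu I)f(\mu)=0$ for all $\mu\in U$ is $f\equiv 0$; it has SVEP on $A\subset\mathbb C$ if it has SVEP at every point of $A$. If $T$ or its dual $T^*$ has SVEP on $\mathbb C\setminus\sigma_W(T)$, then $T$ satisfies property $(Z_{E_a})$ if and only if $E_a(T)=\Pi^0(T)$. -/

import Mathlib

namespace WeylType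

section

variable {X : Type*} [NormedAddCommGroup X] [NormedSpace ℂ X]

/-- The operator `T - l I`. -/
def shift (T : X →L[ℂ] X) (l : ℂ) : X →L[ℂ] X := T - l • (1 : X →L[ℂ] X)

/-- The dual (Banach space adjoint) operator on the topological dual, `φ ↦ φ ∘ T`. -/
noncomputable def dualOp (T : X →L[ℂ] X) : StrongDual ℂ X →L[ℂ] StrongDual ℂ X :=
  ContinuousLinearMap.precomp ℂ T

/-- The index `dim N(T) - dim N(T*)`; it is only used for Fredholm operators,
for which both dimensions are finite. -/
noncomputable def index (T : X →L[ℂ] X) : ℤ :=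
  (Module.finrank ℂ T.ker : ℤ) - (Module.finrank ℂ (dualOp T).ker : ℤ)

/-- Weyl operators: Fredholm operators of index `0`. -/
def IsWeyl (T : X →L[ℂ] X) : Prop := T.IsFredholm ∧ index T = 0

/-- The Weyl spectrum. -/
def weylSpectrum (T : X →L[ℂ] X) : Set ℂ := {l | ¬ IsWeyl (shift T l)}

/-- The ascent, with value `⊤` if the kernels of the powers never stabilise. -/
noncomputable def ascent (T : X →L[ℂ] X) : ℕ∞ :=
  sInf {m : ℕ∞ | ∃ n : ℕ, m = n ∧ (T ^ n).ker = (T ^ (n + 1)).ker}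

/-- The descent, with value `⊤` if the ranges of the powers never stabilise. -/
noncomputable def descent (T : X →L[ℂ] X) : ℕ∞ :=
  sInf {m : ℕ∞ | ∃ n : ℕ, m = n ∧ (T ^ n).range = (T ^ (n + 1)).range}

/-- Poles of the resolvent: spectral points at which `T - l I` has finite ascent and descent. -/
def poles (T : X →L[ℂ] X) : Set ℂ :=
  {l | l ∈ spectrum ℂ T ∧ ascent (shift T l) ≠ ⊤ ∧ descent (shift T l) ≠ ⊤}

/-- Poles of finite rank. At a pole `l` of order `p` the range of the spectral projection is
`N((T - l I)^p)`, which is the union of all the `N((T - l I)^n)`, the generalized eigenspace. -/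
def finiteRankPoles (T : X →L[ℂ] X) : Set ℂ :=
  {l | l ∈ poles T ∧
    FiniteDimensional ℂ (Module.End.maxGenEigenspace (T : Module.End ℂ X) l)}

/-- The approximate point spectrum: `T - l I` is not bounded below. -/
def approxPointSpectrum (T : X →L[ℂ] X) : Set ℂ :=
  {l | ¬ ∃ c : ℝ, 0 < c ∧ ∀ x : X, c * ‖x‖ ≤ ‖shift T l x‖}

/-- The eigenvalues of `T`. -/
def eigenvalues (T : X →L[ℂ] X) : Set ℂ :=
  {l | Module.End.HasEigenvalue (T : Module.End ℂ X) l}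

/-- The isolated points of a subset of the plane. -/
def iso (A : Set ℂ) : Set ℂ := {l | l ∈ A ∧ ¬ AccPt l (Filter.principal A)}

/-- `E_a(T)`: eigenvalues that are isolated points of the approximate point spectrum. -/
def Ea (T : X →L[ℂ] X) : Set ℂ := iso (approxPointSpectrum T) ∩ eigenvalues T

/-- Property `(Z_{E_a})`. -/
def PropertyZEa (T : X →L[ℂ] X) : Prop := spectrum ℂ T \ weylSpectrum T = Ea T

/-- The single-valued extension property at a point: on every connected open neighbourhood `U`
of `l`, zero is the only analytic solution of `(T - m I) f(m) = 0`. -/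
def HasSVEPAt (T : X →L[ℂ] X) (l : ℂ) : Prop :=
  ∀ U : Set ℂ, IsOpen U → IsConnected U → l ∈ U → ∀ f : ℂ → X, AnalyticOnNhd ℂ f U →
    (∀ m ∈ U, shift T m (f m) = 0) → ∀ m ∈ U, f m = 0

/-- The single-valued extension property on a set. -/
def HasSVEPOn (T : X →L[ℂ] X) (A : Set ℂ) : Prop := ∀ l ∈ A, HasSVEPAt T l

end

end WeylType

namespace WeylType

/-! ### Ascent, descent and dimension counts in pure linear algebra. -/

section Algebra

variable {K V : Type*} [Field K] [AddCommGroup V] [Module K V]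

/-! The set E_a plays no role in the argument: under SVEP, σ(T) \ σ_W(T) = Π⁰(T) (Browder's
theorem), and the claim is then symmetry of equality. Let S = T - λI. If λ is a pole of finite rank,
then X = R(Sⁿ) ⊕ N(Sⁿ) for some n, with S invertible on the first summand and the second
finite-dimensional, so S is Weyl. Conversely, let S be Weyl. A nonzero kernel vector in K = ⋂ R(Sⁿ)
would have a chain of preimages in K of geometric growth, hence a power series violating SVEP
(`not_hasSVEPAt_of_surjOn`). So SVEP of T gives finite ascent. SVEP of T* gives T* - λI finite
ascent, which by duality is finite descent of S. Index 0 makes ascent and descent equivalent through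
`finrank_ker_pow_identity`. -/

theorem range_pow_eq_of_range_pow_eq_succ (f : Module.End K V) {n : ℕ}
    (h : (f ^ n).range = (f ^ (n + 1)).range) (m : ℕ) :
    (f ^ n).range = (f ^ (n + m)).range := by
  induction m with
  | zero => rfl
  | succ m ih =>
    rw [h, ← add_assoc, pow_succ', pow_succ', Module.End.mul_eq_comp, Module.End.mul_eq_comp,
      LinearMap.range_comp, LinearMap.range_comp, ih]

/-- An endomorphism with finite ascent and finite descent splits the space. -/
theorem isCompl_ker_range_pow (f : Module.End K V) {p q : ℕ}
    (hp : (f ^ p).ker = (f ^ (p + 1)).ker) (hq : (f ^ q).range = (f ^ (q + 1)).range) :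
    IsCompl (f ^ (p + q)).range (f ^ (p + q)).ker := by
  have hk (m : ℕ) : (f ^ p).ker = (f ^ (p + m)).ker := Module.End.ker_pow_constant hp m
  have hr (m : ℕ) : (f ^ q).range = (f ^ (q + m)).range :=
    range_pow_eq_of_range_pow_eq_succ f hq m
  refine ⟨?_, ?_⟩
  · rw [Submodule.disjoint_def]
    rintro _ ⟨y, rfl⟩ hx
    have h1 : y ∈ (f ^ (p + (q + (p + q)))).ker := by
      rw [LinearMap.mem_ker] at hx ⊢
      rw [show p + (q + (p + q)) = (p + q) + (p + q) by ring, pow_add]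
      exact hx
    rw [← hk, hk q] at h1
    exact h1
  · rw [codisjoint_iff_le_sup]
    intro x _
    -- Ranges are stationary from q on, so f^(p+q) x = f^(2(p+q)) y for some y.
    have h1 : (f ^ (p + q)) x ∈ (f ^ (q + (p + (p + q)))).range := by
      rw [← hr, hr p, add_comm q p]
      exact ⟨x, rfl⟩
    obtain ⟨y, hy⟩ := h1
    refine Submodule.mem_sup.2 ⟨(f ^ (p + q)) y, ⟨y, rfl⟩, x - (f ^ (p + q)) y, ?_, by abel⟩
    rw [LinearMap.mem_ker, map_sub, ← hy, ← Module.End.mul_apply, ← pow_add,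
      show q + (p + (p + q)) = (p + q) + (p + q) by ring, sub_self]

/-- Rank-nullity for f on N(fⁿ⁺¹), whose image is N(fⁿ) ∩ R(f), and for the projection of N(fⁿ) to
V/R(f), whose kernel is that same intersection. -/
theorem finrank_ker_pow_identity (f : Module.End K V) (n : ℕ)
    [FiniteDimensional K (f ^ n).ker] [FiniteDimensional K (f ^ (n + 1)).ker]
    [FiniteDimensional K (V ⧸ f.range)] :
    Module.finrank K (V ⧸ (f.range ⊔ (f ^ n).ker)) + Module.finrank K (f ^ n).ker +
      Module.finrank K f.ker =
    Module.finrank K (V ⧸ f.range) + Module.finrank K (f ^ (n + 1)).ker := by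
  set N := (f ^ n).ker
  set M := (f ^ (n + 1)).ker
  have hfM : f.ker ≤ M := fun x hx => by
    rw [LinearMap.mem_ker] at hx
    simp [M, pow_succ, hx]
  have hMN (x : V) : x ∈ M ↔ f x ∈ N := by
    simp [M, N, pow_succ]
  have e1 : Module.finrank K (N ⊓ f.range : Submodule K V) + Module.finrank K f.ker =
      Module.finrank K M := by
    have h := (f.domRestrict M).finrank_range_add_finrank_ker
    have hr : (f.domRestrict M).range = N ⊓ f.range := by
      ext y
      constructor
      · rintro ⟨x, rfl⟩
        exact ⟨(hMN _).1 x.2, ⟨x, rfl⟩⟩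
      · rintro ⟨hy, x, rfl⟩
        exact ⟨⟨x, (hMN x).2 hy⟩, rfl⟩
    have hk : Module.finrank K (f.domRestrict M).ker = Module.finrank K f.ker := by
      rw [LinearMap.ker_domRestrict]
      exact (Submodule.comapSubtypeEquivOfLe hfM).finrank_eq
    rw [hr, hk] at h
    exact h
  have e2 : Module.finrank K (N.map f.range.mkQ) +
      Module.finrank K (N ⊓ f.range : Submodule K V) = Module.finrank K N := by
    have h := (f.range.mkQ.domRestrict N).finrank_range_add_finrank_ker
    have hk : Module.finrank K (f.range.mkQ.domRestrict N).ker =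
        Module.finrank K (N ⊓ f.range : Submodule K V) := by
      rw [LinearMap.ker_domRestrict, Submodule.ker_mkQ,
        show f.range.comap N.subtype = (N ⊓ f.range).comap N.subtype by
          rw [Submodule.comap_inf, Submodule.comap_subtype_self, top_inf_eq]]
      exact (Submodule.comapSubtypeEquivOfLe inf_le_left).finrank_eq
    rw [hk, LinearMap.range_domRestrict] at h
    exact h
  have e3 : Module.finrank K (V ⧸ (f.range ⊔ N)) + Module.finrank K (N.map f.range.mkQ) =
      Module.finrank K (V ⧸ f.range) := by
    rw [← Submodule.finrank_quotient_add_finrank (N.map f.range.mkQ),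
      (Submodule.quotientQuotientEquivQuotientSup f.range N).finrank_eq]
  omega

/-- R(f) + N(fⁿ) is the preimage of R(fⁿ⁺¹) under fⁿ. -/
theorem range_sup_ker_pow_eq_top_iff (f : Module.End K V) (n : ℕ) :
    f.range ⊔ (f ^ n).ker = ⊤ ↔ (f ^ n).range = (f ^ (n + 1)).range := by
  have h : (f ^ (n + 1)).range = f.range.map (f ^ n) := by
    rw [pow_succ, Module.End.mul_eq_comp, LinearMap.range_comp]
  rw [h, ← Submodule.comap_map_eq]
  constructor
  · intro h
    exact le_antisymm (LinearMap.range_le_iff_comap.2 h) LinearMap.map_le_range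
  · intro h
    rw [← h]
    exact LinearMap.range_le_iff_comap.1 le_rfl

/-- If kernel and cokernel have the same finite dimension, the kernels of the powers are
stationary exactly where the ranges are. -/
theorem ker_pow_eq_succ_iff_range_pow_eq_succ (f : Module.End K V) (n : ℕ)
    [FiniteDimensional K (f ^ n).ker] [FiniteDimensional K (f ^ (n + 1)).ker]
    [FiniteDimensional K (V ⧸ f.range)]
    (h0 : Module.finrank K f.ker = Module.finrank K (V ⧸ f.range)) :
    (f ^ n).ker = (f ^ (n + 1)).ker ↔ (f ^ n).range = (f ^ (n + 1)).range := by
  have hid := finrank_ker_pow_identity f n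
  have hle : (f ^ n).ker ≤ (f ^ (n + 1)).ker := fun x hx => by
    rw [LinearMap.mem_ker] at hx ⊢
    rw [pow_succ', Module.End.mul_apply, hx, map_zero]
  have : FiniteDimensional K (V ⧸ (f.range ⊔ (f ^ n).ker)) :=
    Submodule.CoFG.of_le (le_sup_left : f.range ≤ _) inferInstance
  rw [← range_sup_ker_pow_eq_top_iff, ← Submodule.Quotient.subsingleton_iff,
    ← Module.finrank_zero_iff (R := K)]
  constructor
  · intro h
    rw [h] at hid
    have e := congrArg (fun W : Submodule K V => Module.finrank K (V ⧸ (f.range ⊔ W))) h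
    omega
  · intro h
    exact Submodule.eq_of_le_of_finrank_eq hle (by omega)

theorem antitone_range_pow (f : Module.End K V) : Antitone fun n : ℕ => (f ^ n).range :=
  antitone_nat_of_succ_le fun n => by
    rw [pow_succ, Module.End.mul_eq_comp]
    exact LinearMap.range_comp_le_range _ _

theorem exists_ker_inf_range_pow_stable (f : Module.End K V) [FiniteDimensional K f.ker] :
    ∃ n, ∀ m, n ≤ m → f.ker ⊓ (f ^ n).range ≤ (f ^ m).range := by
  have hanti := antitone_range_pow f
  obtain ⟨n, hn⟩ := IsArtinian.monotone_stabilizes (R := K) (M := f.ker)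
    ⟨fun n => OrderDual.toDual ((f ^ n).range.comap f.ker.subtype),
      fun a b hab => Submodule.comap_mono (hanti hab)⟩
  refine ⟨n, fun m hm x hx => ?_⟩
  have h : (f ^ n).range.comap f.ker.subtype = (f ^ m).range.comap f.ker.subtype := hn m hm
  have hx' : (⟨x, hx.1⟩ : f.ker) ∈ (f ^ n).range.comap f.ker.subtype := hx.2
  rw [h] at hx'
  exact hx'

theorem exists_preimage_mem_iInf_range_pow (f : Module.End K V) [FiniteDimensional K f.ker]
    {y : V} (hy : y ∈ ⨅ n : ℕ, (f ^ n).range) : ∃ x ∈ ⨅ n : ℕ, (f ^ n).range, f x = y := by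
  obtain ⟨d, hd⟩ := exists_ker_inf_range_pow_stable f
  rw [Submodule.mem_iInf] at hy
  have hpre (n : ℕ) : ∃ x ∈ (f ^ n).range, f x = y := by
    obtain ⟨z, hz⟩ := hy (n + 1)
    exact ⟨(f ^ n) z, ⟨z, rfl⟩, by rw [← hz, pow_succ', Module.End.mul_apply]⟩
  have hanti := antitone_range_pow f
  obtain ⟨x, hx, hxy⟩ := hpre d
  refine ⟨x, (Submodule.mem_iInf _).2 fun n => ?_, hxy⟩
  refine hanti (le_max_right d n) ?_
  -- Two preimages of y differ by a kernel vector in R(f^d), which by stability lies in every later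
  -- range.
  obtain ⟨w, hw, hwy⟩ := hpre (max d n)
  have h := hd (max d n) (le_max_left _ _) (x := x - w)
    ⟨by rw [SetLike.mem_coe, LinearMap.mem_ker, map_sub, hxy, hwy, sub_self],
      sub_mem hx (hanti (le_max_left d n) hw)⟩
  simpa using add_mem h hw

/-- If f^(d+1) x = 0, then f^d x lies in N(f) ∩ R(f^d), hence in every range once d is past
stability. -/
theorem exists_ker_pow_eq_succ_of_disjoint (f : Module.End K V) [FiniteDimensional K f.ker]
    (h : ∀ x ∈ ⨅ n : ℕ, (f ^ n).range, f x = 0 → x = 0) :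
    ∃ n : ℕ, (f ^ n).ker = (f ^ (n + 1)).ker := by
  obtain ⟨d, hd⟩ := exists_ker_inf_range_pow_stable f
  have hanti := antitone_range_pow f
  refine ⟨d, le_antisymm (fun x hx => ?_) fun x hx => ?_⟩
  · rw [LinearMap.mem_ker] at hx ⊢
    rw [pow_succ', Module.End.mul_apply, hx, map_zero]
  · rw [LinearMap.mem_ker] at hx ⊢
    rw [pow_succ', Module.End.mul_apply] at hx
    refine h _ ((Submodule.mem_iInf _).2 fun n => ?_) hx
    exact hanti (le_max_right d n) (hd (max d n) (le_max_left _ _) ⟨hx, ⟨x, rfl⟩⟩)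

theorem eq_of_le_of_finrank_quotient_eq {W₁ W₂ : Submodule K V} (h : W₁ ≤ W₂)
    [FiniteDimensional K (V ⧸ W₁)]
    (hd : Module.finrank K (V ⧸ W₁) = Module.finrank K (V ⧸ W₂)) : W₁ = W₂ := by
  have : FiniteDimensional K (V ⧸ W₂) := Submodule.CoFG.of_le h inferInstance
  have hinj := (LinearMap.injective_iff_surjective_of_finrank_eq_finrank hd
    (f := Submodule.factor h)).2 (Submodule.factor_surjective h)
  refine le_antisymm h fun x hx => ?_
  rw [← Submodule.Quotient.mk_eq_zero]
  refine hinj ?_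
  rw [map_zero]
  exact (Submodule.Quotient.mk_eq_zero W₂).2 hx

end Algebra

section Banach

variable {X : Type*} [NormedAddCommGroup X] [NormedSpace ℂ X]

theorem toLinearMap_pow (S : X →L[ℂ] X) (n : ℕ) :
    ((S ^ n : X →L[ℂ] X) : Module.End ℂ X) = (S : Module.End ℂ X) ^ n :=
  map_pow (ContinuousLinearMap.toLinearMapRingHom (R₁ := ℂ) (M₁ := X)) S n

theorem ascent_ne_top_iff (S : X →L[ℂ] X) :
    ascent S ≠ ⊤ ↔ ∃ n : ℕ, (S ^ n).ker = (S ^ (n + 1)).ker := by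
  simp [ascent, sInf_eq_top]

theorem descent_ne_top_iff (S : X →L[ℂ] X) :
    descent S ≠ ⊤ ↔ ∃ n : ℕ, (S ^ n).range = (S ^ (n + 1)).range := by
  simp [descent, sInf_eq_top]

theorem toLinearMap_shift (T : X →L[ℂ] X) (l : ℂ) :
    (shift T l : Module.End ℂ X) = (T : Module.End ℂ X) - l • 1 := rfl

theorem shift_sub_smul (T : X →L[ℂ] X) (l m : ℂ) (x : X) :
    shift T m x = shift T l x - (m - l) • x := by
  simp [shift, sub_smul]

/-! ### Duality and Fredholm operators. -/

theorem dualOp_apply (S : X →L[ℂ] X) (φ : StrongDual ℂ X) (x : X) :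
    dualOp S φ x = φ (S x) := rfl

theorem dualOp_mul (A B : X →L[ℂ] X) : dualOp (A * B) = dualOp B * dualOp A := rfl

set_option synthInstance.maxHeartbeats 200000 in
theorem dualOp_pow (S : X →L[ℂ] X) (n : ℕ) : dualOp (S ^ n) = dualOp S ^ n := by
  induction n with
  | zero => rfl
  | succ n ih => rw [pow_succ, pow_succ', dualOp_mul, ih]

theorem shift_dualOp (T : X →L[ℂ] X) (l : ℂ) : shift (dualOp T) l = dualOp (shift T l) := by
  ext φ x
  simp [shift, dualOp_apply]

/-- The kernel of the dual operator is the dual of the cokernel. -/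
noncomputable def kerDualOpEquiv (S : X →L[ℂ] X) (hc : IsClosed (S.range : Set X))
    [FiniteDimensional ℂ (X ⧸ S.range)] :
    (dualOp S).ker ≃ₗ[ℂ] Module.Dual ℂ (X ⧸ S.range) :=
  have : T2Space (X ⧸ S.range) := by
    have : IsClosed ((S.range).toAddSubgroup : Set X) := hc
    infer_instance
  LinearEquiv.ofBijective
    { toFun := fun φ => S.range.liftQ (φ.1 : X →ₗ[ℂ] ℂ) (by
        rintro _ ⟨x, rfl⟩
        exact congrArg (fun ψ : StrongDual ℂ X => ψ x) φ.2)
      map_add' := fun φ ψ => by ext; rfl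
      map_smul' := fun c φ => by ext; rfl } <| by
    constructor
    · intro φ ψ h
      ext x
      exact congrArg (fun g : Module.Dual ℂ (X ⧸ S.range) => g (S.range.mkQ x)) h
    · intro g
      refine ⟨⟨(LinearMap.toContinuousLinearMap g) ∘L S.range.mkQL, ?_⟩, ?_⟩
      · rw [LinearMap.mem_ker]
        ext x
        have h0 : S.range.mkQ (S x) = 0 := (Submodule.Quotient.mk_eq_zero _).2 ⟨x, rfl⟩
        change g (S.range.mkQ (S x)) = 0
        rw [h0, map_zero]
      · ext x
        rfl

theorem finrank_ker_dualOp {S : X →L[ℂ] X} (hS : S.IsFredholm) :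
    Module.finrank ℂ (dualOp S).ker = Module.finrank ℂ (X ⧸ S.range) := by
  have := hS.finite_coker
  rw [(kerDualOpEquiv S hS.isClosed_range).finrank_eq, Subspace.dual_finrank_eq]

theorem finiteDimensional_ker_dualOp {S : X →L[ℂ] X} (hS : S.IsFredholm) :
    FiniteDimensional ℂ (dualOp S).ker := by
  have := hS.finite_coker
  exact (kerDualOpEquiv S hS.isClosed_range).symm.finiteDimensional

theorem isWeyl_iff (S : X →L[ℂ] X) :
    IsWeyl S ↔ S.IsFredholm ∧
      Module.finrank ℂ S.ker = Module.finrank ℂ (X ⧸ S.range) := by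
  refine and_congr_right fun hS => ?_
  rw [index, finrank_ker_dualOp hS]
  omega

theorem isFredholm_pow {S : X →L[ℂ] X} (hS : S.IsFredholm) (n : ℕ) : (S ^ n).IsFredholm := by
  obtain ⟨v, hv⟩ := hS.exists_isQuasiInverse
  refine ContinuousLinearMap.IsFredholm.of_isQuasiInverse (v := v ^ n) ?_
  induction n with
  | zero => exact (LinearEquiv.refl ℂ X).isQuasiInverse
  | succ n ih =>
    rw [pow_succ v, pow_succ' S]
    exact ih.comp hv

/-- This identity passes to the dual, where it forces the range to be closed. -/
theorem exists_mul_mul_eq {S : X →L[ℂ] X} (hS : S.IsFredholm) :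
    ∃ v : X →L[ℂ] X, S * v * S = S := by
  obtain ⟨pkg⟩ := hS.nonempty_fredholmPackage
  refine ⟨pkg.quasiInverse, ?_⟩
  ext x
  have h (z : X) : S z = pkg.equiv (pkg.decDom.proj z) :=
    congrArg (fun A : X →L[ℂ] X => A z) pkg.eq_equiv
  change S (pkg.decDom.X₁.subtypeL (pkg.equiv.symm (pkg.decCodom.proj (S x)))) = S x
  have h1 : pkg.decCodom.proj (S x) = pkg.equiv (pkg.decDom.proj x) := by
    rw [h x]
    exact Submodule.projectionOnto_apply_left _ _
  rw [h1, ContinuousLinearEquiv.symm_apply_apply, h, h]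
  congr 2
  exact Submodule.projectionOnto_apply_left _ _

theorem isClosed_range_of_mul_mul_eq {Y : Type*} [NormedAddCommGroup Y] [NormedSpace ℂ Y]
    {B W : Y →L[ℂ] Y} (h : B * W * B = B) : IsClosed (B.range : Set Y) := by
  have : (B.range : Set Y) = {y | B (W y) = y} := by
    ext y
    constructor
    · rintro ⟨x, rfl⟩
      exact congrArg (fun A : Y →L[ℂ] Y => A x) h
    · intro hy
      exact ⟨W y, hy⟩
  rw [this]
  exact isClosed_eq (B.continuous.comp W.continuous) continuous_id

theorem isClosed_range_dualOp {S : X →L[ℂ] X} (hS : S.IsFredholm) :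
    IsClosed ((dualOp S).range : Set (StrongDual ℂ X)) := by
  obtain ⟨v, hv⟩ := exists_mul_mul_eq hS
  refine isClosed_range_of_mul_mul_eq (W := dualOp v) ?_
  rw [mul_assoc, ← dualOp_mul, ← dualOp_mul, hv]

/-! ### SVEP and finite ascent. -/

theorem not_hasSVEPAt_of_sequence [CompleteSpace X] (T : X →L[ℂ] X) (l : ℂ) (x : ℕ → X) {C : ℝ}
    (hC : 0 < C) (hx : ∀ n, ‖x n‖ ≤ C ^ n * ‖x 0‖) (h0 : x 0 ≠ 0) (hS0 : shift T l (x 0) = 0)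
    (hS : ∀ n, shift T l (x (n + 1)) = x n) : ¬ HasSVEPAt T l := by
  intro h
  -- On this disc ∑ (w - l)ⁿ xₙ is dominated by a geometric series of ratio 1/2.
  set r : ℝ := (2 * C)⁻¹
  have hr : 0 < r := by positivity
  have hrC : r * C = 1 / 2 := by simp only [r]; field_simp
  have hbound (n : ℕ) (w : ℂ) (hw : w ∈ Metric.ball l r) :
      ‖(w - l) ^ n • x n‖ ≤ (1 / 2) ^ n * ‖x 0‖ := by
    rw [Metric.mem_ball, dist_eq_norm] at hw
    rw [norm_smul, norm_pow, ← hrC, mul_pow, mul_assoc]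
    gcongr
    exact hx n
  have hsum : Summable fun n : ℕ => (1 / 2 : ℝ) ^ n * ‖x 0‖ := summable_geometric_two.mul_right _
  have hdiff : DifferentiableOn ℂ (fun w => ∑' n : ℕ, (w - l) ^ n • x n) (Metric.ball l r) :=
    Complex.differentiableOn_tsum_of_summable_norm hsum
      (fun n => (by fun_prop : Differentiable ℂ fun w : ℂ => (w - l) ^ n • x n).differentiableOn)
      Metric.isOpen_ball hbound
  have hl : l ∈ Metric.ball l r := Metric.mem_ball_self hr
  have key := h _ Metric.isOpen_ball (Metric.isConnected_ball hr) hl _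
    (hdiff.analyticOnNhd Metric.isOpen_ball) ?_ l hl
  · apply h0
    rw [tsum_eq_single 0 (fun n hn => by simp [hn])] at key
    simpa using key
  · intro m hm
    have hs : Summable fun n : ℕ => (m - l) ^ n • x n :=
      hsum.of_norm_bounded fun n => hbound n m hm
    -- Applying T - lI shifts the coefficients down by one and kills x₀, so it acts as
    -- multiplication by m - l.
    rw [shift_sub_smul T l, sub_eq_zero, ContinuousLinearMap.map_tsum _ hs,
      ((shift T l).summable hs).tsum_eq_zero_add, ← tsum_const_smul'' (m - l)]
    simp [hS0, hS, pow_succ', mul_smul]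

theorem not_hasSVEPAt_of_surjOn [CompleteSpace X] (T : X →L[ℂ] X) (l : ℂ) (K : Submodule ℂ X)
    (hK : IsClosed (K : Set X)) (hmaps : Set.MapsTo (shift T l) K K)
    (hsurj : ∀ y ∈ K, ∃ x ∈ K, shift T l x = y) {x₀ : X} (hx₀ : x₀ ∈ K) (hne : x₀ ≠ 0)
    (hker : shift T l x₀ = 0) : ¬ HasSVEPAt T l := by
  have : CompleteSpace K := hK.completeSpace_coe
  -- Open mapping theorem on K: preimages with norm control, to be iterated from x₀.
  obtain ⟨C, hC, hpre⟩ := ((shift T l).restrict hmaps).exists_preimage_norm_le fun y => by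
    obtain ⟨x, hx, hxy⟩ := hsurj y y.2
    exact ⟨⟨x, hx⟩, Subtype.ext hxy⟩
  choose g hg hgn using hpre
  refine not_hasSVEPAt_of_sequence T l (fun n => (g^[n] ⟨x₀, hx₀⟩ : K)) hC (fun n => ?_) hne hker
    fun n => ?_
  · induction n with
    | zero => simp
    | succ n ih =>
      rw [Function.iterate_succ_apply', pow_succ', mul_assoc]
      exact (hgn _).trans (mul_le_mul_of_nonneg_left ih hC.le)
  · rw [Function.iterate_succ_apply']
    exact congrArg Subtype.val (hg _)

theorem exists_ker_pow_eq_succ_of_hasSVEPAt [CompleteSpace X] (T : X →L[ℂ] X) (l : ℂ)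
    (h : HasSVEPAt T l) [FiniteDimensional ℂ (shift T l).ker]
    (hc : ∀ n : ℕ, IsClosed (((shift T l) ^ n).range : Set X)) :
    ∃ n : ℕ, ((shift T l) ^ n).ker = ((shift T l) ^ (n + 1)).ker := by
  set S := shift T l with hSdef
  simp only [toLinearMap_pow] at hc ⊢
  refine exists_ker_pow_eq_succ_of_disjoint _ fun x hx hSx => ?_
  by_contra hne
  refine not_hasSVEPAt_of_surjOn T l (⨅ n : ℕ, ((S : Module.End ℂ X) ^ n).range) ?_ ?_
    (fun y hy => exists_preimage_mem_iInf_range_pow (S : Module.End ℂ X) hy) hx hne hSx h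
  · rw [Submodule.coe_iInf]
    exact isClosed_iInter hc
  · intro y hy
    rw [SetLike.mem_coe, Submodule.mem_iInf] at hy ⊢
    intro n
    obtain ⟨z, rfl⟩ := hy n
    refine ⟨S z, ?_⟩
    exact congrArg (fun A : Module.End ℂ X => A z) (Commute.pow_self (S : Module.End ℂ X) n)

/-- The range of a bounded operator with finite-dimensional kernel and cokernel is closed. -/
theorem isClosed_range_of_isCompl [CompleteSpace X] (A : X →L[ℂ] X) [FiniteDimensional ℂ A.ker]
    (G : Submodule ℂ X) [FiniteDimensional ℂ G] (h : IsCompl A.range G) :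
    IsClosed (A.range : Set X) := by
  obtain ⟨E, hE, hcompl⟩ :=
    (Submodule.ClosedComplemented.of_finiteDimensional A.ker).exists_isClosed_isCompl
  have : CompleteSpace E := hE.completeSpace_coe
  have hr : (A ∘L E.subtypeL).range = A.range := by
    refine le_antisymm (LinearMap.range_comp_le_range _ _) ?_
    rintro _ ⟨x, rfl⟩
    obtain ⟨y, hy, z, hz, rfl⟩ := Submodule.mem_sup.1
      (hcompl.sup_eq_top ▸ Submodule.mem_top : x ∈ A.ker ⊔ E)
    refine ⟨⟨z, hz⟩, ?_⟩
    have hy' : A y = 0 := hy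
    simp [hy']
  have hk : (A ∘L E.subtypeL).ker = ⊥ := by
    rw [LinearMap.ker_eq_bot']
    rintro ⟨z, hz⟩ h0
    exact Subtype.ext (Submodule.disjoint_def.1 hcompl.disjoint z h0 hz)
  rw [← hr] at h ⊢
  exact (A ∘L E.subtypeL).closed_complemented_range_of_isCompl_of_ker_eq_bot G h
    G.closed_of_finiteDimensional hk

theorem isFredholm_of_isCompl [CompleteSpace X] (S : X →L[ℂ] X) (n : ℕ)
    (h : IsCompl (S ^ n).range (S ^ n).ker) [FiniteDimensional ℂ (S ^ n).ker]
    (hk : (S ^ n).ker = (S ^ (n + 1)).ker) (hr : (S ^ n).range = (S ^ (n + 1)).range) :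
    S.IsFredholm := by
  have hcl := isClosed_range_of_isCompl (S ^ n) _ h
  have hco : (S ^ n).range.CoFG :=
    (Submodule.quotientEquivOfIsCompl _ _ h).symm.finiteDimensional
  have hcomm (x : X) : S ((S ^ n) x) = (S ^ n) (S x) :=
    congrArg (fun A : X →L[ℂ] X => A x) (Commute.self_pow S n)
  have hmaps : Set.MapsTo S (S ^ n).range (S ^ n).range := by
    rintro _ ⟨x, rfl⟩
    exact ⟨S x, (hcomm x).symm⟩
  have : CompleteSpace (S ^ n).range := hcl.completeSpace_coe
  refine ContinuousLinearMap.IsFredholm.of_isInvertible_restrict hcl hcl hmaps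
    ⟨ContinuousLinearEquiv.ofBijective (S.restrict hmaps) ?_ ?_, ?_⟩
  · rw [LinearMap.ker_eq_bot']
    rintro ⟨_, x, rfl⟩ h0
    have h1 : S ((S ^ n) x) = 0 := congrArg Subtype.val h0
    have h2 : x ∈ (S ^ (n + 1)).ker := by
      rw [LinearMap.mem_ker, pow_succ']
      exact h1
    rw [← hk] at h2
    exact Subtype.ext h2
  · rw [LinearMap.range_eq_top]
    rintro ⟨y, hy⟩
    obtain ⟨x, hx⟩ := hr ▸ hy
    refine ⟨⟨(S ^ n) x, x, rfl⟩, Subtype.ext ?_⟩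
    refine Eq.trans ?_ hx
    rw [pow_succ']
    rfl
  · ext x
    rfl

/-! ### Finite-rank poles and Weyl points. -/

theorem mem_maxGenEigenspace_iff (T : X →L[ℂ] X) (l : ℂ) (x : X) :
    x ∈ Module.End.maxGenEigenspace (T : Module.End ℂ X) l ↔
      ∃ k : ℕ, x ∈ ((shift T l) ^ k).ker := by
  simp only [toLinearMap_pow, toLinearMap_shift]
  exact Module.End.mem_maxGenEigenspace _ _ _

theorem isWeyl_of_mem_finiteRankPoles [CompleteSpace X] {T : X →L[ℂ] X} {l : ℂ}
    (h : l ∈ finiteRankPoles T) : IsWeyl (shift T l) := by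
  obtain ⟨⟨-, ha, hd⟩, hfin⟩ := h
  obtain ⟨p, hp⟩ := (ascent_ne_top_iff _).1 ha
  obtain ⟨q, hq⟩ := (descent_ne_top_iff _).1 hd
  have hfd (n : ℕ) : FiniteDimensional ℂ ((shift T l) ^ n).ker :=
    Submodule.finiteDimensional_of_le
      (fun x hx => (mem_maxGenEigenspace_iff T l x).2 ⟨n, hx⟩)
  set S := shift T l
  have hcompl : IsCompl (S ^ (p + q)).range (S ^ (p + q)).ker := by
    rw [toLinearMap_pow] at hp hq ⊢
    rw [toLinearMap_pow] at hp hq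
    exact isCompl_ker_range_pow _ hp hq
  have hk : (S ^ (p + q)).ker = (S ^ (p + q + 1)).ker := by
    simp only [toLinearMap_pow] at hp ⊢
    rw [← Module.End.ker_pow_constant hp q, add_assoc, ← Module.End.ker_pow_constant hp (q + 1)]
  have hr : (S ^ (p + q)).range = (S ^ (p + q + 1)).range := by
    simp only [toLinearMap_pow] at hq ⊢
    rw [add_comm p q, ← range_pow_eq_of_range_pow_eq_succ _ hq p, add_assoc,
      ← range_pow_eq_of_range_pow_eq_succ _ hq (p + 1)]
  have hF := isFredholm_of_isCompl S (p + q) hcompl hk hr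
  refine (isWeyl_iff _).2 ⟨hF, ?_⟩
  have := hF.finite_coker
  have hfd' (n : ℕ) : FiniteDimensional ℂ ((S : Module.End ℂ X) ^ n).ker := by
    rw [← toLinearMap_pow]
    exact hfd n
  simp only [toLinearMap_pow] at hk hr
  -- Stationary ranges kill the first term and stationary kernels cancel, leaving dim N(S) = codim
  -- R(S).
  have hid := finrank_ker_pow_identity (S : Module.End ℂ X) (p + q)
  rw [(range_sup_ker_pow_eq_top_iff (S : Module.End ℂ X) (p + q)).2 hr, ← hk,
    Module.finrank_zero_of_subsingleton] at hid
  omega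

/-- N((S*)ⁿ) has dimension codim R(Sⁿ), and nested ranges of equal finite codimension coincide. -/
theorem exists_range_pow_eq_succ_of_dualOp {S : X →L[ℂ] X} (hS : S.IsFredholm) {n : ℕ}
    (h : ((dualOp S) ^ n).ker = ((dualOp S) ^ (n + 1)).ker) :
    (S ^ n).range = (S ^ (n + 1)).range := by
  have := (isFredholm_pow hS (n + 1)).finite_coker
  refine (eq_of_le_of_finrank_quotient_eq ?_ ?_).symm
  · rintro _ ⟨x, rfl⟩
    refine ⟨S x, ?_⟩
    rw [pow_succ]
    rfl
  · rw [← finrank_ker_dualOp (isFredholm_pow hS n),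
      ← finrank_ker_dualOp (isFredholm_pow hS (n + 1)), dualOp_pow, dualOp_pow, h]

theorem mem_finiteRankPoles_of_isWeyl [CompleteSpace X] {T : X →L[ℂ] X} {l : ℂ}
    (hl : l ∈ spectrum ℂ T) (hW : IsWeyl (shift T l))
    (h : HasSVEPAt T l ∨ HasSVEPAt (dualOp T) l) : l ∈ finiteRankPoles T := by
  obtain ⟨hF, h0⟩ := (isWeyl_iff _).1 hW
  have hk := hF.finite_ker
  have hc := hF.finite_coker
  have hfd (n : ℕ) : FiniteDimensional ℂ ((shift T l : Module.End ℂ X) ^ n).ker := by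
    rw [← toLinearMap_pow]
    exact (isFredholm_pow hF n).finite_ker
  have hiff (n : ℕ) : ((shift T l) ^ n).ker = ((shift T l) ^ (n + 1)).ker ↔
      ((shift T l) ^ n).range = ((shift T l) ^ (n + 1)).range := by
    simp only [toLinearMap_pow]
    exact ker_pow_eq_succ_iff_range_pow_eq_succ _ n h0
  obtain ⟨n, hn⟩ : ∃ n : ℕ, ((shift T l) ^ n).ker = ((shift T l) ^ (n + 1)).ker := by
    rcases h with h | h
    · exact exists_ker_pow_eq_succ_of_hasSVEPAt T l h fun n =>
        (isFredholm_pow hF n).isClosed_range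
    · have : FiniteDimensional ℂ (shift (dualOp T) l).ker := by
        rw [shift_dualOp]
        exact finiteDimensional_ker_dualOp hF
      obtain ⟨n, hn⟩ := exists_ker_pow_eq_succ_of_hasSVEPAt (dualOp T) l h fun n => by
        rw [shift_dualOp, ← dualOp_pow]
        exact isClosed_range_dualOp (isFredholm_pow hF n)
      rw [shift_dualOp] at hn
      exact ⟨n, (hiff n).2 (exists_range_pow_eq_succ_of_dualOp hF hn)⟩
  refine ⟨⟨hl, (ascent_ne_top_iff _).2 ⟨n, hn⟩, (descent_ne_top_iff _).2 ⟨n, (hiff n).1 hn⟩⟩, ?_⟩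
  simp only [toLinearMap_pow] at hn
  have := hfd n
  refine Submodule.finiteDimensional_of_le
    (S₂ := ((shift T l : Module.End ℂ X) ^ n).ker) fun x hx => ?_
  obtain ⟨k, hxk⟩ := (mem_maxGenEigenspace_iff T l x).1 hx
  rw [Module.End.ker_pow_constant hn k]
  rw [toLinearMap_pow, LinearMap.mem_ker] at hxk
  rw [LinearMap.mem_ker, pow_add, Module.End.mul_apply, hxk, map_zero]

/-- Browder's theorem for operators with the single-valued extension property. -/
theorem spectrum_diff_weylSpectrum_eq_finiteRankPoles [CompleteSpace X] (T : X →L[ℂ] X)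
    (hT : HasSVEPOn T (weylSpectrum T)ᶜ ∨ HasSVEPOn (dualOp T) (weylSpectrum T)ᶜ) :
    spectrum ℂ T \ weylSpectrum T = finiteRankPoles T := by
  ext l
  constructor
  · rintro ⟨hl, hW⟩
    exact mem_finiteRankPoles_of_isWeyl hl (not_not.1 hW)
      (hT.imp (fun h => h l hW) fun h => h l hW)
  · intro h
    exact ⟨h.1.1, not_not.2 (isWeyl_of_mem_finiteRankPoles h)⟩

end Banach

end WeylType

theorem mainTheorem5 {X : Type*} [NormedAddCommGroup X] [NormedSpace ℂ X] [CompleteSpace X]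
    (hX : ¬ FiniteDimensional ℂ X) (T : X →L[ℂ] X)
    (hT : WeylType.HasSVEPOn T (WeylType.weylSpectrum T)ᶜ ∨
      WeylType.HasSVEPOn (WeylType.dualOp T) (WeylType.weylSpectrum T)ᶜ) :
    WeylType.PropertyZEa T ↔ WeylType.Ea T = WeylType.finiteRankPoles T := by
  rw [WeylType.PropertyZEa, WeylType.spectrum_diff_weylSpectrum_eq_finiteRankPoles T hT]
  exact eq_comm
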